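/- Let $\mathbb{D}=\{z\in\mathbb{C}:|z|<1\}$ and $0<\lambda\le 1$. Let $\mathcal{U}_2(\lambda)$ be the class of functions $f$ analytic in $\mathbb{D}$ with $f(0)=0$, $f'(0)=1$, $f''(0)=0$, $f(z)\ne 0$ for $z\in\mathbb{D}\setminus\{0\}$, and $$\left|\left(\frac{z}{f(z)}\right)^2 f'(z)-1\right|<\lambda\qquad (z\in\mathbb{D}),$$ where $z/f(z)$ is given its limit value $1$ at $z=0$. Suppose that $f\in\mathcal{U}_2(\lambda)$ satisfies $$\frac{z}{f(z)}=1+\lambda a z^2\qquad (z\in\mathbb{D})$$ for some $a\in\mathbb{C}$ with $|a|\le 1$. Then $f$ is convex in the direction $\gamma=2\pi-\frac{\arg a}{2}$, for every choice of the argument $\arg a$ (any real number if $a=0$); that is, $f$ is injective in $\mathbb{D}$ and every line parallel to the line through $0$ and $e^{i\gamma}$ meets $f(\mathbb{D})$ in a connected (possibly empty) set. -/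

import Mathlib

open Complex Metric Set

noncomputable section

/-- The class `𝒜`: functions analytic in the open unit disk with `f 0 = 0` and `f' 0 = 1`.
Functions are total on `ℂ`; only their values on the unit disk matter. -/
def ClassA : Set (ℂ → ℂ) :=
  {f | AnalyticOnNhd ℂ f (ball 0 1) ∧ f 0 = 0 ∧ deriv f 0 = 1}

/-- The function `z / f z`, with its removable singularity at the origin filled in
(its limit at `0` is `1` for `f` in the class `𝒜`). -/
def quotFun (f : ℂ → ℂ) (z : ℂ) : ℂ :=
  if z = 0 then 1 else z / f z

/-- `U_f z = (z / f z) ^ 2 * f' z - 1`. -/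
def Ufun (f : ℂ → ℂ) (z : ℂ) : ℂ :=
  quotFun f z ^ 2 * deriv f z - 1

/-- The class `𝒰(lam)`: those `f` in `𝒜` with `|U_f z| < lam` in the unit disk. The condition that
`f` has no zero off the origin says that `U_f` is defined throughout the disk. -/
def ClassU (lam : ℝ) : Set (ℂ → ℂ) :=
  {f | f ∈ ClassA ∧ (∀ z ∈ ball (0 : ℂ) 1, z ≠ 0 → f z ≠ 0) ∧
    ∀ z ∈ ball (0 : ℂ) 1, ‖Ufun f z‖ < lam}

/-- The class `𝒰₂(lam)`: those `f` in `𝒰(lam)` with `f'' 0 = 0`. -/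
def ClassU2 (lam : ℝ) : Set (ℂ → ℂ) :=
  ClassU lam ∩ {f | iteratedDeriv 2 f 0 = 0}

/-- The line through `w` parallel to the line through `0` and `exp (i γ)`. -/
def lineInDirection (w : ℂ) (γ : ℝ) : Set ℂ :=
  range fun t : ℝ => w + (t : ℂ) * exp ((γ : ℂ) * I)

/-- A set `D` is convex in the direction `γ` if every line parallel to the line through `0` and
`exp (i γ)` meets `D` in a connected (possibly empty) set. -/
def IsConvexInDirection (D : Set ℂ) (γ : ℝ) : Prop :=
  ∀ w : ℂ, IsPreconnected (lineInDirection w γ ∩ D)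

/-- A function is convex in the direction `γ` if it is univalent (analytic and injective) in the
unit disk and the image of the unit disk is convex in the direction `γ`. -/
def IsFunConvexInDirection (f : ℂ → ℂ) (γ : ℝ) : Prop :=
  AnalyticOnNhd ℂ f (ball 0 1) ∧ InjOn f (ball 0 1) ∧ IsConvexInDirection (f '' ball 0 1) γ

end

/-!
Write `b = lam * ‖a‖ ∈ [0, 1]` and `e = exp (i γ) = exp (-i α / 2)`. The hypothesis on `z / f z`
says `f z = e * g (z / e)` on the disk, where `g z = z / (1 + b z ^ 2)`. So `f` is injective because
`g` is, and it is enough that horizontal lines meet `g (𝔻)` in intervals.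

The reciprocal of `g` is the Joukowski-type map `1 / z + b z`, which sends the unit circle to an
ellipse with semi-axes `1 + b` and `1 - b`; inverting, `g (𝔻)` is the region
`(1 - b ^ 2) ^ 2 * ‖w‖ ^ 4 < (1 - b) ^ 2 * (re w) ^ 2 + (1 + b) ^ 2 * (im w) ^ 2`, at least off the
real axis (`mem_image_quadInv_iff`). This rests on a polynomial identity (`ellipseGap_quadInv`) and
on the fact that `z` and `1 / (b z)` have the same image. For fixed `im w ≠ 0` the defining
expression is concave in `(re w) ^ 2`, and it is positive at `re w = 0` as soon as it is positive
somewhere; hence `g (𝔻)` contains, with each point, all points of the same height nearer to the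
imaginary axis (`mem_image_quadInv_of_abs_re_le`). On the real axis, where the description of the
region fails for `b = 1`, only real `z` contribute and the intermediate value theorem applies.
-/

open Complex Metric Set

/-- The map `z ↦ z / (1 + b z ^ 2)`, the reciprocal of the Joukowski-type map `1 / z + b z`. -/
noncomputable def quadInv (b : ℝ) (z : ℂ) : ℂ := z / (1 + b * z ^ 2)

/-- The quartic expression in `w = u + i v` that is positive exactly when `1 / w` lies outside the
ellipse with semi-axes `1 + b` and `1 - b` (for `0 ≤ b < 1` and `w ≠ 0`). -/
def ellipseGap (b u v : ℝ) : ℝ :=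
  (1 - b) ^ 2 * u ^ 2 + (1 + b) ^ 2 * v ^ 2 - (1 - b ^ 2) ^ 2 * (u ^ 2 + v ^ 2) ^ 2

lemma one_add_mul_sq_ne_zero {c z : ℂ} (hc : ‖c‖ ≤ 1) (hz : ‖z‖ < 1) : 1 + c * z ^ 2 ≠ 0 := by
  intro h
  have h1 : c * z ^ 2 = -1 := by linear_combination h
  have h2 : ‖c‖ * ‖z‖ ^ 2 = 1 := by
    rw [← norm_pow, ← norm_mul, h1, norm_neg, norm_one]
  nlinarith [norm_nonneg c, norm_nonneg z, sq_nonneg ‖z‖]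

lemma norm_ofReal_le_one {b : ℝ} (hb0 : 0 ≤ b) (hb1 : b ≤ 1) : ‖(b : ℂ)‖ ≤ 1 := by
  rwa [norm_real, Real.norm_of_nonneg hb0]

lemma quadInv_injOn {b : ℝ} (hb0 : 0 ≤ b) (hb1 : b ≤ 1) :
    InjOn (quadInv b) (ball 0 1) := by
  intro z hz w hw h
  rw [mem_ball_zero_iff] at hz hw
  have hb := norm_ofReal_le_one hb0 hb1
  rw [quadInv, quadInv, div_eq_div_iff (one_add_mul_sq_ne_zero hb hz)
    (one_add_mul_sq_ne_zero hb hw)] at h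
  have h1 : (z - w) * (1 - b * (z * w)) = 0 := by linear_combination h
  rcases mul_eq_zero.mp h1 with h2 | h2
  · exact sub_eq_zero.mp h2
  · have h3 : ‖(b : ℂ)‖ * (‖z‖ * ‖w‖) = 1 := by
      rw [← norm_mul, ← norm_mul, ← sub_eq_zero.mp h2, norm_one]
    have h4 : ‖z‖ * ‖w‖ < 1 := by nlinarith [norm_nonneg z, norm_nonneg w]
    nlinarith [mul_nonneg (norm_nonneg z) (norm_nonneg w)]

/-- The relation `w (1 + b z ^ 2) = z` in real coordinates, with `N = ‖1 + b z ^ 2‖ ^ 2`. -/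
lemma re_im_of_mul_eq {b : ℝ} {z w : ℂ} (h : w * (1 + b * z ^ 2) = z) :
    w.re * normSq (1 + b * z ^ 2) = z.re * (1 + b * normSq z) ∧
      w.im * normSq (1 + b * z ^ 2) = z.im * (1 - b * normSq z) := by
  have hre := congrArg re h
  have him := congrArg im h
  simp only [mul_re, mul_im, add_re, add_im, one_re, one_im, ofReal_re, ofReal_im, sq] at hre him
  simp only [normSq_apply, mul_re, mul_im, add_re, add_im, one_re, one_im, ofReal_re, ofReal_im, sq]
  constructor
  · linear_combination (1 + b * (z.re * z.re - z.im * z.im)) * hre + 2 * b * z.re * z.im * him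
  · linear_combination (1 + b * (z.re * z.re - z.im * z.im)) * him - 2 * b * z.re * z.im * hre

/-- If `w (1 + b z ^ 2) = z`, the sign of the gap at `w` is decided by the position of `‖z‖`
relative to `1` and `1 / b`. -/
lemma ellipseGap_quadInv {b : ℝ} {z w : ℂ} (h : w * (1 + b * z ^ 2) = z) :
    ellipseGap b w.re w.im * normSq (1 + b * z ^ 2) ^ 2 =
      (1 - normSq z) * (1 - b ^ 2 * normSq z) *
        ((1 - b) ^ 2 * z.re ^ 2 + (1 + b) ^ 2 * z.im ^ 2) := by
  obtain ⟨hre, him⟩ := re_im_of_mul_eq h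
  have hw : normSq w * normSq (1 + b * z ^ 2) = normSq z := by rw [← normSq_mul, h]
  have hws : normSq w = w.re ^ 2 + w.im ^ 2 := by rw [normSq_apply]; ring
  have hzs : normSq z = z.re ^ 2 + z.im ^ 2 := by rw [normSq_apply]; ring
  rw [ellipseGap, ← hws]
  generalize normSq (1 + b * z ^ 2) = N at *
  calc _ = (1 - b) ^ 2 * (w.re * N) ^ 2 + (1 + b) ^ 2 * (w.im * N) ^ 2
        - (1 - b ^ 2) ^ 2 * (normSq w * N) ^ 2 := by ring
    _ = _ := by rw [hre, him, hw, hzs]; ring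

lemma exists_mul_one_add_mul_sq_eq (b : ℝ) (w : ℂ) : ∃ z : ℂ, w * (1 + b * z ^ 2) = z := by
  by_cases h : (b : ℂ) * w = 0
  · exact ⟨w, by linear_combination w ^ 2 * h⟩
  · obtain ⟨s, hs⟩ := IsAlgClosed.exists_pow_nat_eq (discrim (b * w) (-1) w) two_pos
    obtain ⟨z, hz⟩ := exists_quadratic_eq_zero h ⟨s, by rw [← hs, sq]⟩
    exact ⟨z, by linear_combination hz⟩

/-- Off the real axis, the image of the unit disk under `z ↦ z / (1 + b z ^ 2)` is the inverse of
the exterior of an ellipse. -/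
lemma mem_image_quadInv_iff {b : ℝ} (hb0 : 0 ≤ b) (hb1 : b ≤ 1) {w : ℂ} (hw : w.im ≠ 0) :
    w ∈ quadInv b '' ball 0 1 ↔ 0 < ellipseGap b w.re w.im := by
  have hb := norm_ofReal_le_one hb0 hb1
  constructor
  · rintro ⟨z, hz, rfl⟩
    rw [mem_ball_zero_iff] at hz
    have hN := one_add_mul_sq_ne_zero hb hz
    have h : quadInv b z * (1 + b * z ^ 2) = z := div_mul_cancel₀ _ hN
    have him : z.im ≠ 0 := by
      intro h0
      have h1 := (re_im_of_mul_eq h).2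
      rw [h0, zero_mul] at h1
      exact (mul_ne_zero hw (normSq_pos.mpr hN).ne') h1
    have hs : normSq z < 1 := by
      rw [normSq_eq_norm_sq]; nlinarith [norm_nonneg z]
    have hs0 := normSq_nonneg z
    have hbs : b ^ 2 * normSq z < 1 :=
      (mul_le_of_le_one_left hs0 (pow_le_one₀ hb0 hb1)).trans_lt hs
    refine pos_of_mul_pos_left ?_ (sq_nonneg (normSq (1 + b * z ^ 2)))
    rw [ellipseGap_quadInv h]
    have hi : 0 < z.im ^ 2 := by positivity
    have h1 : 0 < 1 - normSq z := by linarith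
    have h2 : 0 < 1 - b ^ 2 * normSq z := by linarith
    positivity
  · intro hE
    obtain ⟨z, h⟩ := exists_mul_one_add_mul_sq_eq b w
    have hw0 : w ≠ 0 := by rintro rfl; simp at hw
    have hz0 : z ≠ 0 := by
      rintro rfl
      apply hw0
      simpa using h
    have hN : 1 + b * z ^ 2 ≠ 0 := by
      intro h0
      rw [h0, mul_zero] at h
      exact hz0 h.symm
    have hp : 0 < (1 - normSq z) * (1 - b ^ 2 * normSq z) := by
      have hN2 : 0 < normSq (1 + b * z ^ 2) ^ 2 := pow_pos (normSq_pos.mpr hN) 2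
      refine pos_of_mul_pos_left ?_
        (by positivity : 0 ≤ (1 - b) ^ 2 * z.re ^ 2 + (1 + b) ^ 2 * z.im ^ 2)
      rw [← ellipseGap_quadInv h]
      exact mul_pos hE hN2
    rcases lt_or_ge ‖z‖ 1 with hz | hz
    · exact ⟨z, by rwa [mem_ball_zero_iff], (eq_div_of_mul_eq hN h).symm⟩
    · -- The other root `1 / (b z)` of `w (1 + b z ^ 2) = z` then lies in the disk.
      have hs : 1 ≤ normSq z := by rw [normSq_eq_norm_sq]; nlinarith
      have hbs : 1 < b ^ 2 * normSq z := by nlinarith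
      have hb' : b ≠ 0 := by rintro rfl; norm_num at hbs
      have hbC : (b : ℂ) ≠ 0 := ofReal_ne_zero.mpr hb'
      have hn : 1 < ‖(b : ℂ) * z‖ := by
        rw [normSq_eq_norm_sq] at hbs
        rw [norm_mul, norm_real, Real.norm_of_nonneg hb0]
        nlinarith [mul_nonneg hb0 (norm_nonneg z)]
      have hz1 : ‖((b : ℂ) * z)⁻¹‖ < 1 := by
        rw [norm_inv]
        exact inv_lt_one_of_one_lt₀ hn
      refine ⟨((b : ℂ) * z)⁻¹, by rwa [mem_ball_zero_iff], ?_⟩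
      refine (eq_div_of_mul_eq (one_add_mul_sq_ne_zero hb hz1) ?_).symm
      field_simp
      linear_combination h

/-- For fixed `v`, positivity of the gap persists when `|u|` decreases: the gap is concave in
`u ^ 2`, and it is positive at `u = 0` if it is positive anywhere. -/
lemma ellipseGap_pos_of_sq_le {b u u' v : ℝ} (hb0 : 0 ≤ b) (hv : v ≠ 0) (hu : u' ^ 2 ≤ u ^ 2)
    (h : 0 < ellipseGap b u v) : 0 < ellipseGap b u' v := by
  unfold ellipseGap at *
  have hAB : (1 - b) ^ 2 ≤ (1 + b) ^ 2 := by nlinarith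
  have hB : 0 < (1 + b) ^ 2 := by positivity
  have hA : 0 ≤ (1 - b) ^ 2 := sq_nonneg _
  have hq : 0 < v ^ 2 := by positivity
  have hp' : 0 ≤ u' ^ 2 := sq_nonneg _
  rw [show (1 - b ^ 2) ^ 2 = (1 - b) ^ 2 * (1 + b) ^ 2 by ring] at *
  generalize (1 - b) ^ 2 = A at *
  generalize (1 + b) ^ 2 = B at *
  generalize v ^ 2 = q at *
  generalize u ^ 2 = p at *
  generalize u' ^ 2 = p' at *
  have hAq : A * q < 1 := by
    by_contra! hAq
    have h1 : 1 ≤ A * (p + q) := by nlinarith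
    have h2 : B * (p + q) ≤ B * (p + q) * (A * (p + q)) :=
      le_mul_of_one_le_right (mul_nonneg hB.le (by linarith)) h1
    nlinarith
  have h0 : 0 < B * q * (1 - A * q) := mul_pos (mul_pos hB hq) (by linarith)
  rcases hp'.eq_or_lt with rfl | hpos
  · nlinarith
  -- Concavity, with `p'` written as a convex combination of `0` and `p`.
  · have hp : 0 < p := hpos.trans_le hu
    have h1 : 0 < p' * (A * p + B * q - A * B * (p + q) ^ 2) := mul_pos hpos h
    have h2 : 0 ≤ (p - p') * (B * q * (1 - A * q)) := mul_nonneg (by linarith) h0.le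
    have h3 : 0 ≤ A * B * (p * p' * (p - p')) :=
      mul_nonneg (mul_nonneg hA hB.le) (mul_nonneg (mul_nonneg hp.le hp') (by linarith))
    refine pos_of_mul_pos_right (a := p) ?_ hp.le
    linarith [show p * (A * p' + B * q - A * B * (p' + q) ^ 2) =
      p' * (A * p + B * q - A * B * (p + q) ^ 2) + (p - p') * (B * q * (1 - A * q))
        + A * B * (p * p' * (p - p')) by ring]

/-- The image of the unit disk under `z ↦ z / (1 + b z ^ 2)` contains, with each point, all points
of the same height that are nearer to the imaginary axis. -/
lemma mem_image_quadInv_of_abs_re_le {b : ℝ} (hb0 : 0 ≤ b) (hb1 : b ≤ 1) {w w' : ℂ}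
    (hw : w ∈ quadInv b '' ball 0 1) (him : w'.im = w.im) (hre : |w'.re| ≤ |w.re|) :
    w' ∈ quadInv b '' ball 0 1 := by
  by_cases hv : w.im = 0
  · obtain ⟨z, hz, rfl⟩ := hw
    rw [mem_ball_zero_iff] at hz
    have hN := one_add_mul_sq_ne_zero (norm_ofReal_le_one hb0 hb1) hz
    have h : quadInv b z * (1 + b * z ^ 2) = z := div_mul_cancel₀ _ hN
    have hs : normSq z < 1 := by
      rw [normSq_eq_norm_sq]; nlinarith [norm_nonneg z]
    have hz0 : z.im = 0 := by
      have h1 := (re_im_of_mul_eq h).2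
      rw [hv, zero_mul] at h1
      have h2 : 1 - b * normSq z ≠ 0 := by nlinarith [normSq_nonneg z]
      exact (mul_eq_zero.mp h1.symm).resolve_right h2
    obtain ⟨x, rfl⟩ : ∃ x : ℝ, z = x := ⟨z.re, Complex.ext rfl hz0⟩
    have hreal : ∀ t : ℝ, quadInv b t = ((t / (1 + b * t ^ 2) : ℝ) : ℂ) := by
      intro t; rw [quadInv]; push_cast; rfl
    have hpos : ∀ t : ℝ, 0 < 1 + b * t ^ 2 := fun t => by positivity
    have hcont : ContinuousOn (fun t : ℝ => t / (1 + b * t ^ 2)) (Icc (-|x|) |x|) := by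
      refine ContinuousOn.div (by fun_prop) (by fun_prop) fun t _ => (hpos t).ne'
    rw [hreal, ofReal_re, abs_div, abs_of_pos (hpos x)] at hre
    have hmem := intermediate_value_Icc (neg_le_self (abs_nonneg x)) hcont
      (show w'.re ∈ _ from ?_)
    · obtain ⟨t, ht, hte⟩ := hmem
      refine ⟨t, ?_, ?_⟩
      · rw [norm_real, Real.norm_eq_abs] at hz
        rw [mem_ball_zero_iff, norm_real, Real.norm_eq_abs]
        exact (abs_le.mpr ht).trans_lt hz
      · rw [hreal]
        exact Complex.ext (by rw [ofReal_re]; exact hte) (by rw [him, hv, ofReal_im])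
    · simp only [even_two.neg_pow, sq_abs, neg_div]
      exact abs_le.mp hre
  · rw [mem_image_quadInv_iff hb0 hb1 hv] at hw
    rw [mem_image_quadInv_iff hb0 hb1 (him ▸ hv), him]
    exact ellipseGap_pos_of_sq_le hb0 hv (sq_le_sq.mpr hre) hw

lemma ordConnected_setOf_add_mem_image_quadInv {b : ℝ} (hb0 : 0 ≤ b) (hb1 : b ≤ 1) (w : ℂ) :
    OrdConnected {t : ℝ | w + t ∈ quadInv b '' ball 0 1} := by
  refine ⟨fun s hs t ht x hx => ?_⟩
  have hmax : |w.re + x| ≤ max |w.re + s| |w.re + t| := by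
    refine abs_le_max_abs_abs ?_ ?_
    · linarith [hx.1]
    · linarith [hx.2]
  rcases le_max_iff.mp hmax with h | h
  · exact mem_image_quadInv_of_abs_re_le hb0 hb1 hs (by simp) (by simpa using h)
  · exact mem_image_quadInv_of_abs_re_le hb0 hb1 ht (by simp) (by simpa using h)

theorem theorem2 (lam : ℝ) (hlam_pos : 0 < lam) (hlam_le : lam ≤ 1) (a : ℂ) (ha : ‖a‖ ≤ 1)
    (f : ℂ → ℂ) (hf : f ∈ ClassU2 lam)
    (hform : ∀ z ∈ Metric.ball (0 : ℂ) 1, quotFun f z = 1 + (lam : ℂ) * (a * z ^ 2))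
    (α : ℝ) (hα : a = (‖a‖ : ℂ) * Complex.exp ((α : ℂ) * Complex.I)) :
    IsFunConvexInDirection f (2 * Real.pi - α / 2) := by
  obtain ⟨⟨⟨han, hf0, -⟩, hne, -⟩, -⟩ := hf
  have hb0 : 0 ≤ lam * ‖a‖ := by positivity
  have hb1 : lam * ‖a‖ ≤ 1 := mul_le_one₀ hlam_le (norm_nonneg a) ha
  have hγ : exp (((2 * Real.pi - α / 2 : ℝ) : ℂ) * I) = exp (((-(α / 2) : ℝ) : ℂ) * I) := by
    rw [← exp_periodic (((-(α / 2) : ℝ) : ℂ) * I)]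
    congr 1
    push_cast
    ring
  have he : ‖exp (((-(α / 2) : ℝ) : ℂ) * I)‖ = 1 := norm_exp_ofReal_mul_I _
  have hsq : exp ((α : ℂ) * I) * exp (((-(α / 2) : ℝ) : ℂ) * I) ^ 2 = 1 := by
    rw [← exp_nat_mul, ← exp_add, ← exp_zero]
    congr 1
    push_cast
    ring
  unfold IsFunConvexInDirection IsConvexInDirection lineInDirection
  rw [hγ]
  generalize exp (((-(α / 2) : ℝ) : ℂ) * I) = e at he hsq
  have he0 : e ≠ 0 := by
    rintro rfl
    simp at he
  have hball : ∀ z : ℂ, z * e⁻¹ ∈ ball (0 : ℂ) 1 ↔ z ∈ ball (0 : ℂ) 1 := by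
    intro z
    rw [mem_ball_zero_iff, mem_ball_zero_iff, norm_mul, norm_inv, he, inv_one, mul_one]
  have hfg : ∀ z ∈ ball (0 : ℂ) 1, f z = e * quadInv (lam * ‖a‖) (z * e⁻¹) := by
    intro z hz
    by_cases hz0 : z = 0
    · rw [hz0, hf0]
      simp [quadInv]
    · have h1 := hform z hz
      rw [quotFun, if_neg hz0] at h1
      have h2 : 1 + (lam : ℂ) * (a * z ^ 2)
          = 1 + ((lam * ‖a‖ : ℝ) : ℂ) * (z * e⁻¹) ^ 2 := by
        have h3 : exp ((α : ℂ) * I) = (e⁻¹) ^ 2 := by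
          rw [inv_pow]
          exact eq_inv_of_mul_eq_one_left hsq
        rw [h3] at hα
        push_cast
        linear_combination (lam : ℂ) * z ^ 2 * hα
      rw [quadInv, ← h2, ← h1]
      have := hne z hz hz0
      field_simp
  have himg : ∀ w : ℂ, w ∈ f '' ball 0 1 ↔ w * e⁻¹ ∈ quadInv (lam * ‖a‖) '' ball 0 1 := by
    intro w
    constructor
    · rintro ⟨z, hz, rfl⟩
      refine ⟨z * e⁻¹, (hball z).mpr hz, ?_⟩
      rw [hfg z hz]
      field_simp
    · rintro ⟨z, hz, h⟩
      have hz' : z * e ∈ ball (0 : ℂ) 1 := by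
        rw [← hball, mul_inv_cancel_right₀ he0]
        exact hz
      refine ⟨z * e, hz', ?_⟩
      rw [hfg _ hz', mul_inv_cancel_right₀ he0, h]
      field_simp
  refine ⟨han, ?_, fun w => ?_⟩
  · intro z hz z' hz' h
    rw [hfg z hz, hfg z' hz'] at h
    exact mul_right_cancel₀ (inv_ne_zero he0)
      (quadInv_injOn hb0 hb1 ((hball z).mpr hz) ((hball z').mpr hz') (mul_left_cancel₀ he0 h))
  · have hset : range (fun t : ℝ => w + (t : ℂ) * e) ∩ f '' ball 0 1 =
        (fun t : ℝ => w + (t : ℂ) * e) ''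
          {t : ℝ | w * e⁻¹ + t ∈ quadInv (lam * ‖a‖) '' ball 0 1} := by
      have hadd : ∀ t : ℝ, (w + (t : ℂ) * e) * e⁻¹ = w * e⁻¹ + t := fun t => by
        field_simp
      ext p
      constructor
      · rintro ⟨⟨t, rfl⟩, hp⟩
        exact ⟨t, by rwa [mem_ofPred_eq, ← hadd, ← himg], rfl⟩
      · rintro ⟨t, ht, rfl⟩
        exact ⟨⟨t, rfl⟩, by rw [himg, hadd]; exact ht⟩
    rw [hset]
    exact (ordConnected_setOf_add_mem_image_quadInv hb0 hb1 _).isPreconnected.image _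
      (by fun_prop)
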